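/- All rings are commutative with identity. For a ring $A$ and an $A$-module $C$, the cotorsion dimension $\mathrm{cd}_A(C)$ is the least integer $n\ge 0$ such that $\mathrm{Ext}_A^{n+1}(F,C)=0$ for all flat $A$-modules $F$ (and $\infty$ if there is no such $n$), and the global cotorsion dimension of $A$ is $\mathrm{cot.D}(A)=\sup\{\mathrm{cd}_A(C) : C \text{ an } A\text{-module}\}\in\{0,1,2,\dots\}\cup\{\infty\}$. For an integer $n\ge 0$, the ring $A$ is called $n$-perfect if every flat $A$-module has projective dimension at most $n$. Let $T$ be an integral domain of the form $T=K+M$, where $K$ is a subring of $T$ that is a field and $M\neq 0$ is a maximal ideal of $T$. Let $D\subsetneq K$ be a proper subring of $K$ whose quotient field is $K$, and let $R=D+M=\{d+m : d\in D,\ m\in M\}$, a subring of $T$. Then $$\mathrm{cot.D}(R)=\sup\{\mathrm{cot.D}(T),\ \mathrm{cot.D}(D)\}.$$ Moreover, for every integer $n\ge 0$, the ring $R$ is $n$-perfect if and only if both $T$ and $D$ are $n$-perfect. -/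

import Mathlib

universe u

open CategoryTheory

/-- The cotorsion dimension of an `R`-module `C`: the least natural number `n` such that
`Ext^{n+1}_R(F, C) = 0` for all flat `R`-modules `F`, and `⊤` if there is no such `n`. -/
noncomputable def cotorsionDim (R : Type u) [CommRing R] (C : ModuleCat.{u} R) : ℕ∞ :=
  ⨅ (n : ℕ) (_ : ∀ F : ModuleCat.{u} R, Module.Flat R F →
    Subsingleton (Abelian.Ext F C (n + 1))), (n : ℕ∞)

/-- The global cotorsion dimension of `R`: the supremum of the cotorsion dimensions
of all `R`-modules. -/
noncomputable def globalCotorsionDim (R : Type u) [CommRing R] : ℕ∞ :=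
  ⨆ C : ModuleCat.{u} R, cotorsionDim R C

/-- `R` is `n`-perfect if every flat `R`-module has projective dimension at most `n`. -/
def IsNPerfect (n : ℕ) (R : Type u) [CommRing R] : Prop :=
  ∀ F : ModuleCat.{u} R, Module.Flat R F → HasProjectiveDimensionLE F n

/-- The subring `D + M = {d + m | d ∈ D, m ∈ M}` of `T`, for a subring `D` and an ideal `M`. -/
def dPlusM {T : Type u} [CommRing T] (D : Subring T) (M : Ideal T) : Subring T where
  carrier := {x | ∃ d ∈ D, ∃ m ∈ M, d + m = x}
  zero_mem' := ⟨0, D.zero_mem, 0, M.zero_mem, add_zero 0⟩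
  one_mem' := ⟨1, D.one_mem, 0, M.zero_mem, add_zero 1⟩
  add_mem' := by
    rintro _ _ ⟨d, hd, m, hm, rfl⟩ ⟨e, he, k, hk, rfl⟩
    exact ⟨d + e, D.add_mem hd he, m + k, M.add_mem hm hk, by ring⟩
  neg_mem' := by
    rintro _ ⟨d, hd, m, hm, rfl⟩
    exact ⟨-d, D.neg_mem hd, -m, M.neg_mem hm, by ring⟩
  mul_mem' := by
    rintro _ _ ⟨d, hd, m, hm, rfl⟩ ⟨e, he, k, hk, rfl⟩
    exact ⟨d * e, D.mul_mem hd he, d * k + (e + k) * m,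
      M.add_mem (M.mul_mem_left _ hk) (M.mul_mem_left _ hm), by ring⟩

/-! A bound cot.D(A) ≤ n says that Ext^{n+1}(F, C) = 0 for all flat F and all C, that is, that A is
n-perfect, so only the n-perfect equivalence needs proof.

From R to T and D: T is the localization of R at D∖0, hence a flat epimorphism, and R ≅ D ⊕ M is
flat over D with D as a retract. So every flat T- or D-module is a base change of a flat R-module,
and base change does not raise the projective dimension of flat modules.

From T and D to R: M is an ideal of both R and T, and R/M = D. For a flat syzygy Q, a retraction
onto Q over D lifts to R up to an error in MQ, and a retraction over T absorbs that error because MT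
⊆ R (`projective_of_projective_baseChange`). Passing to flat syzygies extends this from projective
modules to dimension n. -/

open TensorProduct

/-! ### Purity of sequences with flat cokernel. -/

section Flat

variable {R : Type u} [CommRing R] {Q P F : Type u}
  [AddCommGroup Q] [Module R Q] [AddCommGroup P] [Module R P] [AddCommGroup F] [Module R F]
  {f : Q →ₗ[R] P} {g : P →ₗ[R] F}

theorem lTensor_rTensor_comm {A B C E : Type u} [AddCommGroup A] [AddCommGroup B] [AddCommGroup C]
    [AddCommGroup E] [Module R A] [Module R B] [Module R C] [Module R E]
    (a : A →ₗ[R] B) (b : C →ₗ[R] E) (x : A ⊗[R] C) :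
    b.lTensor B (a.rTensor C x) = a.rTensor E (b.lTensor A x) := by
  rw [← LinearMap.comp_apply, ← LinearMap.comp_apply, LinearMap.lTensor_comp_rTensor,
    LinearMap.rTensor_comp_lTensor]

/-- A diagram chase in place of Tor₁(N, F) = 0: tensor L → A → N with Q → P → F. Flatness of F makes
L ⊗ F → A ⊗ F injective, and flatness of A makes A ⊗ Q → A ⊗ P injective. -/
theorem lTensor_injective_of_flat_presentation [Module.Flat R F] (hf : Function.Injective f)
    (hfg : Function.Exact f g) (hg : Function.Surjective g)
    {L A N : Type u} [AddCommGroup L] [Module R L] [AddCommGroup A] [Module R A] [Module.Flat R A]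
    [AddCommGroup N] [Module R N] {k : L →ₗ[R] A} {p : A →ₗ[R] N} (hk : Function.Injective k)
    (hkp : Function.Exact k p) (hp : Function.Surjective p) :
    Function.Injective (f.lTensor N) := by
  rw [injective_iff_map_eq_zero]
  intro z hz
  obtain ⟨z', rfl⟩ := LinearMap.rTensor_surjective Q hp z
  rw [lTensor_rTensor_comm] at hz
  obtain ⟨y, hy⟩ := (rTensor_exact P hkp hp _).1 hz
  have hy0 : g.lTensor _ y = 0 := by
    apply Module.Flat.rTensor_preserves_injective_linearMap (M := F) k hk
    rw [map_zero, ← lTensor_rTensor_comm, hy]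
    exact (lTensor_exact _ hfg hg _).2 ⟨_, rfl⟩
  obtain ⟨x, rfl⟩ := (lTensor_exact _ hfg hg _).1 hy0
  rw [← lTensor_rTensor_comm] at hy
  have hx := Module.Flat.lTensor_preserves_injective_linearMap (M := A) f hf hy
  rw [← hx]
  exact (rTensor_exact Q hkp hp _).2 ⟨_, rfl⟩

/-- A short exact sequence with flat cokernel is pure. -/
theorem lTensor_injective_of_flat_cokernel [Module.Flat R F] (hf : Function.Injective f)
    (hfg : Function.Exact f g) (hg : Function.Surjective g)
    (N : Type u) [AddCommGroup N] [Module R N] : Function.Injective (f.lTensor N) :=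
  lTensor_injective_of_flat_presentation hf hfg hg (Submodule.subtype_injective _)
    (Finsupp.linearCombination R (id : N → N)).exact_subtype_ker_map
    (Finsupp.linearCombination_id_surjective R N)

theorem flat_of_flat_of_flat_cokernel [Module.Flat R P] [Module.Flat R F]
    (hf : Function.Injective f) (hfg : Function.Exact f g) (hg : Function.Surjective g) :
    Module.Flat R Q := by
  rw [Module.Flat.iff_rTensor_injectiveₛ]
  intro A _ _ B
  let : AddCommGroup A := Module.addCommMonoidToAddCommGroup R
  let : AddCommGroup B := inferInstanceAs (AddCommGroup B)
  have h := (Module.Flat.rTensor_preserves_injective_linearMap (M := P) B.subtype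
      Subtype.val_injective).comp (lTensor_injective_of_flat_cokernel hf hfg hg B)
  rw [← LinearMap.coe_comp, LinearMap.rTensor_comp_lTensor, ← LinearMap.lTensor_comp_rTensor,
    LinearMap.coe_comp] at h
  exact h.of_comp

end Flat

/-! ### Flat syzygies and base change. -/

section ProjectiveDimension

variable {R : Type u} [CommRing R]

theorem hasProjectiveDimensionLE_zero_iff (F : Type u) [AddCommGroup F] [Module R F] :
    HasProjectiveDimensionLE (ModuleCat.of R F) 0 ↔ Module.Projective R F := by
  rw [← projective_iff_hasProjectiveDimensionLE_zero, IsProjective.iff_projective]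

theorem hasProjectiveDimensionLE_of_linearEquiv {F G : Type u} [AddCommGroup F] [Module R F]
    [AddCommGroup G] [Module R G] (e : F ≃ₗ[R] G) (n : ℕ)
    (h : HasProjectiveDimensionLE (ModuleCat.of R F) n) :
    HasProjectiveDimensionLE (ModuleCat.of R G) n :=
  hasProjectiveDimensionLT_of_iso e.toModuleIso _

variable {Q P F : Type u}
  [AddCommGroup Q] [Module R Q] [AddCommGroup P] [Module R P] [AddCommGroup F] [Module R F]
  {f : Q →ₗ[R] P} {g : P →ₗ[R] F}

theorem shortExact_of_exact (hf : Function.Injective f)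
    (hfg : Function.Exact f g) (hg : Function.Surjective g) :
    (ShortComplex.mk (ModuleCat.ofHom f) (ModuleCat.ofHom g)
      (by rw [← ModuleCat.ofHom_comp, hfg.linearMap_comp_eq_zero]; rfl)).ShortExact where
  exact := (ShortComplex.ShortExact.moduleCat_exact_iff_function_exact _).2 hfg
  mono_f := (ModuleCat.mono_iff_injective _).2 hf
  epi_g := (ModuleCat.epi_iff_surjective _).2 hg

theorem hasProjectiveDimensionLE_succ_iff [Module.Projective R P] (hf : Function.Injective f)
    (hfg : Function.Exact f g) (hg : Function.Surjective g) (n : ℕ) :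
    HasProjectiveDimensionLE (ModuleCat.of R F) (n + 1) ↔
      HasProjectiveDimensionLE (ModuleCat.of R Q) n :=
  (shortExact_of_exact hf hfg hg).hasProjectiveDimensionLT_X₃_iff n
    ((IsProjective.iff_projective P).1 inferInstance)

/-- A flat module has a presentation by a free module with flat kernel. -/
theorem exists_free_presentation (F : Type u) [AddCommGroup F] [Module R F] [Module.Flat R F] :
    ∃ (Q P : ModuleCat.{u} R) (f : Q →ₗ[R] P) (g : P →ₗ[R] F), Module.Projective R P ∧
      Module.Flat R Q ∧ Function.Injective f ∧ Function.Exact f g ∧ Function.Surjective g := by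
  let g : (F →₀ R) →ₗ[R] F := Finsupp.linearCombination R id
  have hg : Function.Surjective g := Finsupp.linearCombination_id_surjective R F
  exact ⟨ModuleCat.of R (LinearMap.ker g), ModuleCat.of R (F →₀ R), (LinearMap.ker g).subtype, g,
    inferInstanceAs (Module.Projective R (F →₀ R)),
    flat_of_flat_of_flat_cokernel Subtype.val_injective g.exact_subtype_ker_map hg,
    Subtype.val_injective, g.exact_subtype_ker_map, hg⟩

/-- Base change does not increase the projective dimension of a flat module. -/
theorem hasProjectiveDimensionLE_baseChange (S : Type u) [CommRing S] [Algebra R S] (n : ℕ)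
    (F : Type u) [AddCommGroup F] [Module R F] [Module.Flat R F]
    (h : HasProjectiveDimensionLE (ModuleCat.of R F) n) :
    HasProjectiveDimensionLE (ModuleCat.of S (S ⊗[R] F)) n := by
  induction n generalizing F with
  | zero =>
    rw [hasProjectiveDimensionLE_zero_iff] at h ⊢
    infer_instance
  | succ n ih =>
    obtain ⟨Q, P, f, g, hP, hQ, hf, hfg, hg⟩ := exists_free_presentation (R := R) F
    rw [hasProjectiveDimensionLE_succ_iff hf hfg hg] at h
    rw [hasProjectiveDimensionLE_succ_iff (f := f.baseChange S) (g := g.baseChange S)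
      (lTensor_injective_of_flat_cokernel hf hfg hg S) (lTensor_exact S hfg hg)
      (LinearMap.lTensor_surjective S hg)]
    exact ih Q h

end ProjectiveDimension

/-! ### Cotorsion dimension versus n-perfectness. -/

section CotorsionDim

variable {R : Type u} [CommRing R]

/-- Dimension shift: Ext^{n+2}(F, C) is a quotient of Ext^{n+1}(Q, C) for a flat syzygy Q of F. -/
theorem subsingleton_ext_succ {C : ModuleCat.{u} R} {n : ℕ}
    (h : ∀ F : ModuleCat.{u} R, Module.Flat R F → Subsingleton (Abelian.Ext F C (n + 1)))
    (F : ModuleCat.{u} R) (hF : Module.Flat R F) : Subsingleton (Abelian.Ext F C (n + 2)) := by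
  obtain ⟨Q, P, f, g, hP, hQ, hf, hfg, hg⟩ := exists_free_presentation (R := R) F
  have : Projective P := (IsProjective.iff_projective P).1 hP
  have hQ' := h Q hQ
  refine subsingleton_of_forall_eq 0 fun x => ?_
  obtain ⟨y, rfl⟩ := Abelian.Ext.contravariant_sequence_exact₃
    (shortExact_of_exact hf hfg hg) C x (Abelian.Ext.eq_zero_of_projective _)
    (n₀ := n + 1) (by omega)
  have : y = 0 := Subsingleton.elim (α := Abelian.Ext Q C (n + 1)) _ _
  rw [this, Abelian.Ext.comp_zero]

theorem cotorsionDim_le_iff {C : ModuleCat.{u} R} {n : ℕ} :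
    cotorsionDim R C ≤ n ↔
      ∀ F : ModuleCat.{u} R, Module.Flat R F → Subsingleton (Abelian.Ext F C (n + 1)) := by
  refine ⟨fun h => ?_, fun h => iInf₂_le n h⟩
  -- A strict bound on the infimum yields an actual index k ≤ n where Ext vanishes.
  have h' : cotorsionDim R C < (n + 1 : ℕ) := h.trans_lt (by exact_mod_cast n.lt_succ_self)
  simp only [cotorsionDim, iInf_lt_iff] at h'
  obtain ⟨k, hk, hkn⟩ := h'
  replace hkn : k ≤ n := Nat.lt_succ_iff.1 (by exact_mod_cast hkn)
  clear h
  induction n, hkn using Nat.le_induction with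
  | base => exact hk
  | succ m _ ih =>
    exact subsingleton_ext_succ ih

theorem globalCotorsionDim_le_iff {n : ℕ} : globalCotorsionDim R ≤ n ↔ IsNPerfect n R := by
  rw [globalCotorsionDim, iSup_le_iff]
  constructor
  · refine fun h F hF => (hasProjectiveDimensionLT_iff _ _).2 fun i hi C e => ?_
    obtain ⟨i, rfl⟩ : ∃ j, i = j + 1 := ⟨i - 1, by omega⟩
    have : Subsingleton (Abelian.Ext F C (i + 1)) :=
      cotorsionDim_le_iff.1 ((h C).trans (by exact_mod_cast Nat.le_of_succ_le_succ hi)) F hF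
    exact Subsingleton.elim _ _
  · refine fun h C => cotorsionDim_le_iff.2 fun F hF => ?_
    have := h F hF
    exact HasProjectiveDimensionLT.subsingleton F (n + 1) (n + 1) le_rfl C

end CotorsionDim

/-! ### Descent of projectivity from T and D to R. -/

section Descent

variable {R D T : Type u} [CommRing R] [CommRing D] [CommRing T] [Algebra R D] [Algebra R T]

/-- Right exactness of the tensor product, applied to ker → R → D. -/
theorem mem_range_of_one_tmul_eq_zero (hRD : Function.Surjective (algebraMap R D))
    {Q : Type u} [AddCommGroup Q] [Module R Q] {q : Q} (h : (1 : D) ⊗ₜ[R] q = 0) :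
    q ∈ RingHom.ker (algebraMap R D) • (⊤ : Submodule R Q) := by
  have h' : (Algebra.linearMap R D).rTensor Q (1 ⊗ₜ q) = 0 := by simpa using h
  obtain ⟨y, hy⟩ := (rTensor_exact Q
    (f := (LinearMap.ker (Algebra.linearMap R D)).subtype)
    (LinearMap.exact_subtype_ker_map _) hRD _).1 h'
  have hq : q = TensorProduct.lid R Q
      ((LinearMap.ker (Algebra.linearMap R D)).subtype.rTensor Q y) := by simp [hy]
  rw [hq]
  clear hq hy
  induction y with
  | zero => simp
  | tmul a x =>
    simpa using Submodule.smul_mem_smul (I := RingHom.ker (algebraMap R D)) (RingHom.mem_ker.2 a.2)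
      (Submodule.mem_top (x := x))
  | add x y hx hy => simpa using add_mem hx hy

/-- A flat module over `R` is projective if its base changes to `T` and to the quotient `D` are,
where the kernel of `R → D` is the image of an ideal of the overring `T`. -/
theorem projective_of_projective_baseChange (hRD : Function.Surjective (algebraMap R D))
    (hRT : Function.Injective (algebraMap R T))
    (hI : ∀ r ∈ RingHom.ker (algebraMap R D), ∀ t : T, ∃ s : R, algebraMap R T s = r • t)
    (F : Type u) [AddCommGroup F] [Module R F] [Module.Flat R F]
    [hT : Module.Projective T (T ⊗[R] F)] [hD : Module.Projective D (D ⊗[R] F)] :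
    Module.Projective R F := by
  obtain ⟨Q, P, f, g, hP, hQ, hf, hfg, hg⟩ := exists_free_presentation (R := R) F
  -- retractions of the base changes of `f`
  have retr (A : Type u) [CommRing A] [Algebra R A] [Module.Projective A (A ⊗[R] F)] :
      ∃ ρ : A ⊗[R] P →ₗ[A] A ⊗[R] Q, ∀ x, ρ (f.baseChange A x) = x := by
    have hf' : Function.Injective (f.baseChange A) := lTensor_injective_of_flat_cokernel hf hfg hg A
    have hfg' : Function.Exact (f.baseChange A) (g.baseChange A) := lTensor_exact A hfg hg
    have hg' : Function.Surjective (g.baseChange A) := LinearMap.lTensor_surjective A hg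
    obtain ⟨ρ, hρ⟩ := ((hfg'.split_tfae' (R := A)).out 0 1 rfl rfl).1
      ⟨hf', Module.projective_lifting_property _ LinearMap.id hg'⟩ |>.2
    exact ⟨ρ, fun x => congr($hρ x)⟩
  obtain ⟨ρT, hρT⟩ := retr T
  obtain ⟨ρD, hρD⟩ := retr D
  -- Q embeds in T ⊗ Q, so maps landing in its image can be pulled back to Q.
  have hQT : Function.Injective (TensorProduct.mk R T Q 1) := by
    have h1 := Module.Flat.rTensor_preserves_injective_linearMap (M := Q)
      (Algebra.linearMap R T) hRT
    intro x y hxy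
    refine (TensorProduct.lid R Q).symm.injective (h1 ?_)
    simpa using hxy
  have hQD : Function.Surjective (TensorProduct.mk R D Q 1) := fun z => by
    induction z with
    | zero => exact ⟨0, by simp⟩
    | tmul d q =>
      obtain ⟨r, rfl⟩ := hRD d
      exact ⟨r • q, by simp [Algebra.algebraMap_eq_smul_one, TensorProduct.smul_tmul]⟩
    | add x y hx hy =>
      obtain ⟨a, rfl⟩ := hx
      obtain ⟨b, rfl⟩ := hy
      exact ⟨a + b, by simp [TensorProduct.tmul_add]⟩
  -- a first approximation to a retraction of `f`, correct modulo the kernel of `R → D`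
  obtain ⟨φ, hφ⟩ := Module.projective_lifting_property (TensorProduct.mk R D Q 1)
    (ρD.restrictScalars R ∘ₗ TensorProduct.mk R D P 1) hQD
  let δ : Q →ₗ[R] Q := LinearMap.id - φ ∘ₗ f
  have hδ (q : Q) : δ q ∈ RingHom.ker (algebraMap R D) • (⊤ : Submodule R Q) := by
    refine mem_range_of_one_tmul_eq_zero hRD ?_
    have h1 : (1 : D) ⊗ₜ[R] φ (f q) = ρD (1 ⊗ₜ f q) := congr($hφ (f q))
    have h2 : ρD (1 ⊗ₜ f q) = (1 : D) ⊗ₜ[R] q := by simpa using hρD (1 ⊗ₜ q)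
    simp [δ, TensorProduct.tmul_sub, h1, h2]
  -- the error term extends to `P` through the base change to `T`
  have hIT (q : Q) (hq : q ∈ RingHom.ker (algebraMap R D) • (⊤ : Submodule R Q)) (t : T) :
      t ⊗ₜ[R] q ∈ LinearMap.range (TensorProduct.mk R T Q 1) := by
    refine Submodule.smul_induction_on hq (fun r hr q _ => ?_) fun x y hx hy => ?_
    · obtain ⟨s, hs⟩ := hI r hr t
      refine ⟨s • q, ?_⟩
      rw [TensorProduct.mk_apply, ← TensorProduct.smul_tmul, ← Algebra.algebraMap_eq_smul_one, hs,
        TensorProduct.smul_tmul]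
    · rw [TensorProduct.tmul_add]
      exact add_mem hx hy
  have hrange (z : T ⊗[R] Q) : δ.baseChange T z ∈ LinearMap.range (TensorProduct.mk R T Q 1) := by
    induction z with
    | zero => simp
    | tmul t q => exact hIT _ (hδ q) t
    | add x y hx hy =>
      rw [map_add]
      exact add_mem hx hy
  let ψ : P →ₗ[R] Q := (LinearEquiv.ofInjective _ hQT).symm.toLinearMap ∘ₗ
    ((δ.baseChange T).restrictScalars R ∘ₗ ρT.restrictScalars R ∘ₗ
      TensorProduct.mk R T P 1).codRestrict _ fun p => hrange _
  have hψ (q : Q) : ψ (f q) = δ q := by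
    refine (LinearEquiv.symm_apply_eq _).2 (Subtype.ext ?_)
    have h2 : ρT (1 ⊗ₜ f q) = (1 : T) ⊗ₜ[R] q := by simpa using hρT (1 ⊗ₜ q)
    change δ.baseChange T (ρT (1 ⊗ₜ f q)) = 1 ⊗ₜ δ q
    rw [h2, LinearMap.baseChange_tmul]
  -- φ + ψ retracts f, since ψ ∘ f = δ = id - φ ∘ f.
  obtain ⟨σ, hσ⟩ := ((hfg.split_tfae' (R := R)).out 1 0 rfl rfl).1
    ⟨hg, φ + ψ, LinearMap.ext fun q => by simp [hψ, δ]⟩ |>.2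
  exact Module.Projective.of_split σ g hσ

theorem hasProjectiveDimensionLE_of_baseChange (hRD : Function.Surjective (algebraMap R D))
    (hRT : Function.Injective (algebraMap R T))
    (hI : ∀ r ∈ RingHom.ker (algebraMap R D), ∀ t : T, ∃ s : R, algebraMap R T s = r • t) (n : ℕ)
    (F : Type u) [AddCommGroup F] [Module R F] [Module.Flat R F]
    (hT : HasProjectiveDimensionLE (ModuleCat.of T (T ⊗[R] F)) n)
    (hD : HasProjectiveDimensionLE (ModuleCat.of D (D ⊗[R] F)) n) :
    HasProjectiveDimensionLE (ModuleCat.of R F) n := by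
  induction n generalizing F with
  | zero =>
    rw [hasProjectiveDimensionLE_zero_iff] at hT hD ⊢
    exact projective_of_projective_baseChange hRD hRT hI F
  | succ n ih =>
    obtain ⟨Q, P, f, g, hP, hQ, hf, hfg, hg⟩ := exists_free_presentation (R := R) F
    rw [hasProjectiveDimensionLE_succ_iff hf hfg hg]
    have key (A : Type u) [CommRing A] [Algebra R A] :=
      hasProjectiveDimensionLE_succ_iff (f := f.baseChange A) (g := g.baseChange A)
        (lTensor_injective_of_flat_cokernel hf hfg hg A) (lTensor_exact A hfg hg)
        (LinearMap.lTensor_surjective A hg) n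
    exact ih Q ((key T).1 hT) ((key D).1 hD)

end Descent

/-! ### n-perfectness along R → T and D → R → D. -/

section Perfect

variable {R D T : Type u} [CommRing R] [CommRing D] [CommRing T]

/-- For an epimorphism R → T, a T-module F satisfies T ⊗_R F ≅ F. -/
theorem IsNPerfect.of_flat_of_isEpi [Algebra R T] [Module.Flat R T] [Algebra.IsEpi R T] {n : ℕ}
    (h : IsNPerfect n R) : IsNPerfect n T := by
  intro F hF
  let : Module R F := Module.compHom F (algebraMap R T)
  have : IsScalarTower R T F := ⟨fun r t x => by
    rw [Algebra.smul_def, mul_smul]; rfl⟩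
  have : Module.Flat R F := Module.Flat.trans R T F
  exact hasProjectiveDimensionLE_of_linearEquiv (TensorProduct.lid' R T F) n
    (hasProjectiveDimensionLE_baseChange T n F (h (ModuleCat.of R F) this))

/-- D → R → D is the identity, so D ⊗_R (R ⊗_D F) ≅ F. -/
theorem IsNPerfect.of_flat_retract [Algebra D R] [Algebra R D] [IsScalarTower D R D]
    [Module.Flat D R] {n : ℕ} (h : IsNPerfect n R) : IsNPerfect n D := by
  intro F hF
  exact hasProjectiveDimensionLE_of_linearEquiv
    (TensorProduct.AlgebraTensorModule.cancelBaseChange D R D D F ≪≫ₗ TensorProduct.lid D F) n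
    (hasProjectiveDimensionLE_baseChange D n (R ⊗[D] F)
      (h (ModuleCat.of R (R ⊗[D] F)) (inferInstanceAs (Module.Flat R (R ⊗[D] F)))))

theorem isNPerfect_iff [Algebra R T] [Module.Flat R T] [Algebra.IsEpi R T]
    [Algebra D R] [Algebra R D] [IsScalarTower D R D] [Module.Flat D R]
    (hRT : Function.Injective (algebraMap R T))
    (hI : ∀ r ∈ RingHom.ker (algebraMap R D), ∀ t : T, ∃ s : R, algebraMap R T s = r • t) (n : ℕ) :
    IsNPerfect n R ↔ IsNPerfect n T ∧ IsNPerfect n D := by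
  refine ⟨fun h => ⟨h.of_flat_of_isEpi, h.of_flat_retract⟩, fun h F hF => ?_⟩
  have hRD : Function.Surjective (algebraMap R D) := fun d =>
    ⟨algebraMap D R d, by
      rw [← IsScalarTower.algebraMap_apply D R D, Algebra.algebraMap_self_apply]⟩
  exact hasProjectiveDimensionLE_of_baseChange hRD hRT hI n F
    (h.1 (ModuleCat.of T (T ⊗[R] F)) (inferInstanceAs (Module.Flat T (T ⊗[R] F))))
    (h.2 (ModuleCat.of D (D ⊗[R] F)) (inferInstanceAs (Module.Flat D (D ⊗[R] F))))

end Perfect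

/-! ### The ring D + M. -/

section DPlusM

theorem IsField.flat {K : Type u} [CommRing K] (hK : IsField K) (V : Type u) [AddCommGroup V]
    [Module K V] : Module.Flat K V := by
  let := hK.toField
  exact Module.Flat.of_free

theorem flat_prod {R A B : Type u} [CommRing R] [AddCommGroup A] [Module R A] [AddCommGroup B]
    [Module R B] [Module.Flat R A] [Module.Flat R B] : Module.Flat R (A × B) := by
  refine Module.Flat.iff_lTensor_preserves_injective_linearMap.2 fun X Y _ _ _ _ f hf => ?_
  have h : (TensorProduct.prodLeft R R A B Y).toLinearMap ∘ₗ f.lTensor (A × B) =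
      (f.lTensor A).prodMap (f.lTensor B) ∘ₗ (TensorProduct.prodLeft R R A B X).toLinearMap := by
    ext <;> simp
  have hinj : Function.Injective ((TensorProduct.prodLeft R R A B Y).toLinearMap ∘ₗ
      f.lTensor (A × B)) := by
    rw [h]
    exact ((Module.Flat.lTensor_preserves_injective_linearMap f hf).prodMap
      (Module.Flat.lTensor_preserves_injective_linearMap f hf)).comp (LinearEquiv.injective _)
  rw [LinearMap.coe_comp] at hinj
  exact hinj.of_comp

variable {T : Type u} [CommRing T] {K : Subring T} {M : Ideal T} {D : Subring K}

theorem eq_zero_of_mem_of_isMaximal (hK : IsField K) (hM : M.IsMaximal) {k : K}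
    (hk : (k : T) ∈ M) : k = 0 := by
  by_contra h
  obtain ⟨l, hl⟩ := hK.mul_inv_cancel h
  exact hM.ne_top (M.eq_top_of_isUnit_mem hk (IsUnit.of_mul_eq_one (l : T) congr(($hl : T))))

/-- The inclusion of `D` into `D + M`. -/
def dPlusM.incl (D : Subring K) (M : Ideal T) : D →+* dPlusM (D.map K.subtype) M :=
  (K.subtype.comp D.subtype).codRestrict _ fun d =>
    ⟨_, ⟨d, d.2, rfl⟩, 0, M.zero_mem, add_zero _⟩

theorem dPlusM.exists_sub_mem (r : dPlusM (D.map K.subtype) M) :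
    ∃ d : D, (r : T) - (d : K) ∈ M := by
  obtain ⟨_, _, ⟨d, hd, rfl⟩, m, hm, rfl⟩ := r
  exact ⟨⟨d, hd⟩, by simpa using hm⟩

/-- The projection of `D + M` onto `D`. -/
theorem dPlusM.exists_proj (hK : IsField K) (hM : M.IsMaximal) :
    ∃ π : dPlusM (D.map K.subtype) M →+* D,
      ∀ r : dPlusM (D.map K.subtype) M, (r : T) - (π r : K) ∈ M := by
  choose π hπ using dPlusM.exists_sub_mem (D := D) (M := M)
  -- K ∩ M = 0 makes the D-component unique, so the chosen π respects the ring operations.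
  have uniq {r : T} {d e : D} (hd : r - (d : K) ∈ M) (he : r - (e : K) ∈ M) : d = e := by
    have h : ((d - e : D) : K) = 0 := eq_zero_of_mem_of_isMaximal hK hM (by
      have := M.sub_mem he hd
      push_cast
      rwa [sub_sub_sub_cancel_left] at this)
    exact sub_eq_zero.1 (Subtype.ext h)
  exact ⟨
    { toFun := π
      map_one' := uniq (hπ 1) (by simp)
      map_zero' := uniq (hπ 0) (by simp)
      map_add' := fun r s => uniq (hπ (r + s)) (by
        have := M.add_mem (hπ r) (hπ s)
        push_cast
        rwa [add_sub_add_comm])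
      map_mul' := fun r s => uniq (hπ (r * s)) (by
        have := M.add_mem (M.mul_mem_left (s : T) (hπ r)) (M.mul_mem_left ((π r : K) : T) (hπ s))
        push_cast
        convert this using 1
        ring) }, hπ⟩

theorem dPlusM.isLocalization [IsDomain T] (hT : ∀ t : T, ∃ k ∈ K, ∃ m ∈ M, k + m = t)
    [hDK : IsFractionRing D K] :
    IsLocalization ((nonZeroDivisors D).map (dPlusM.incl D M)) T where
  map_units := by
    rintro ⟨_, d, hd, rfl⟩
    exact (IsLocalization.map_units K (⟨d, hd⟩ : nonZeroDivisors D)).map K.subtype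
  surj t := by
    obtain ⟨k, hk, m, hm, rfl⟩ := hT t
    obtain ⟨⟨a, b⟩, hab⟩ := IsLocalization.surj (nonZeroDivisors D) (⟨k, hk⟩ : K)
    -- With k = a/b, multiplying k + m by b gives a + mb, which lies in D + M.
    refine ⟨⟨⟨((a : K) : T) + m * ((b : D) : K), ?_⟩, ⟨_, b, b.2, rfl⟩⟩, ?_⟩
    · exact ⟨_, ⟨a, a.2, rfl⟩, _, M.mul_mem_right _ hm, rfl⟩
    · have hab' : k * (((b : D) : K) : T) = ((a : K) : T) := congr(($hab : T))
      change (k + m) * (((b : D) : K) : T) = _ + _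
      rw [add_mul, hab']
  exists_of_eq h := ⟨1, by rw [Subtype.ext h]⟩

/-- As a D-module the ring is D ⊕ M, and M is a vector space over K, which is flat over D. -/
theorem dPlusM.flat (hK : IsField K) (hM : M.IsMaximal) [IsFractionRing D K]
    [Algebra D (dPlusM (D.map K.subtype) M)]
    (h : algebraMap D (dPlusM (D.map K.subtype) M) = dPlusM.incl D M) :
    Module.Flat D (dPlusM (D.map K.subtype) M) := by
  have := hK.flat M
  have : Module.Flat D K := IsLocalization.flat K (nonZeroDivisors D)
  have : Module.Flat D M := Module.Flat.trans D K M
  let j : M →ₗ[D] dPlusM (D.map K.subtype) M :=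
    { toFun := fun m => ⟨m, 0, zero_mem _, m, m.2, zero_add _⟩
      map_add' := fun _ _ => rfl
      map_smul' := fun d m => by
        rw [Algebra.smul_def, h]
        rfl }
  have hval (d : D) (m : M) :
      (((Algebra.linearMap D _).coprod j (d, m) : dPlusM (D.map K.subtype) M) : T) =
        (d : K) + (m : T) := by
    simp only [LinearMap.coprod_apply, Algebra.linearMap_apply, h]
    rfl
  have : Module.Flat D (D × M) := flat_prod
  refine Module.Flat.of_linearEquiv (LinearEquiv.ofBijective
    ((Algebra.linearMap D (dPlusM (D.map K.subtype) M)).coprod j) ⟨?_, fun r => ?_⟩).symm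
  · rw [injective_iff_map_eq_zero]
    rintro ⟨d, m⟩ hdm
    have h0 : ((d : K) : T) + m = 0 := by rw [← hval, hdm]; rfl
    have hd : (d : K) = 0 := eq_zero_of_mem_of_isMaximal hK hM (by
      rw [eq_neg_of_add_eq_zero_left h0]
      exact M.neg_mem m.2)
    have hm : (m : T) = 0 := by simpa [hd] using h0
    exact Prod.ext (Subtype.ext hd) (Subtype.ext hm)
  · obtain ⟨d, hd⟩ := dPlusM.exists_sub_mem r
    exact ⟨(d, ⟨_, hd⟩), Subtype.ext (by rw [hval]; simp)⟩

theorem isNPerfect_dPlusM_iff [IsDomain T] (hK : IsField K) (hM : M.IsMaximal)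
    (hT : ∀ t : T, ∃ k ∈ K, ∃ m ∈ M, k + m = t) [IsFractionRing D K] (n : ℕ) :
    IsNPerfect n (dPlusM (D.map K.subtype) M) ↔ IsNPerfect n T ∧ IsNPerfect n D := by
  obtain ⟨π, hπ⟩ := dPlusM.exists_proj (D := D) hK hM
  have := dPlusM.isLocalization (D := D) hT
  have : Module.Flat (dPlusM (D.map K.subtype) M) T :=
    IsLocalization.flat T ((nonZeroDivisors D).map (dPlusM.incl D M))
  have : Algebra.IsEpi (dPlusM (D.map K.subtype) M) T :=
    ⟨(IsLocalization.bijective_linearMap_mul' ((nonZeroDivisors D).map (dPlusM.incl D M)) T).1⟩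
  let : Algebra D (dPlusM (D.map K.subtype) M) := (dPlusM.incl D M).toAlgebra
  let : Algebra (dPlusM (D.map K.subtype) M) D := π.toAlgebra
  have : IsScalarTower D (dPlusM (D.map K.subtype) M) D := IsScalarTower.of_algebraMap_eq fun d => by
    have h := hπ (dPlusM.incl D M d)
    have h0 : ((d - π (dPlusM.incl D M d) : D) : K) = 0 :=
      eq_zero_of_mem_of_isMaximal hK hM (by push_cast; exact h)
    exact sub_eq_zero.1 (Subtype.ext h0)
  have : Module.Flat D (dPlusM (D.map K.subtype) M) := dPlusM.flat hK hM rfl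
  refine isNPerfect_iff Subtype.val_injective (fun r hr t => ?_) n
  have hr : (r : T) ∈ M := by
    have h := hπ r
    rwa [show π r = 0 from hr, Subring.coe_zero, Subring.coe_zero, sub_zero] at h
  exact ⟨⟨r * t, 0, zero_mem _, _, M.mul_mem_right t hr, zero_add _⟩, rfl⟩

end DPlusM

theorem theorem3p3 {T : Type u} [CommRing T] [IsDomain T]
    (K : Subring T) (hK : IsField K)
    (M : Ideal T) (hM : M.IsMaximal) (hM0 : M ≠ ⊥)
    (hT : ∀ t : T, ∃ k ∈ K, ∃ m ∈ M, k + m = t)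
    (D : Subring K) (hD : D ≠ ⊤) (hDK : IsFractionRing D K) :
    globalCotorsionDim (dPlusM (D.map K.subtype) M) =
        globalCotorsionDim T ⊔ globalCotorsionDim D ∧
      ∀ n : ℕ, IsNPerfect n (dPlusM (D.map K.subtype) M) ↔
        IsNPerfect n T ∧ IsNPerfect n D := by
  have key := fun n => isNPerfect_dPlusM_iff (D := D) hK hM hT n
  refine ⟨?_, key⟩
  have h (n : ℕ) : globalCotorsionDim (dPlusM (D.map K.subtype) M) ≤ n ↔
      globalCotorsionDim T ⊔ globalCotorsionDim D ≤ n := by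
    rw [sup_le_iff, globalCotorsionDim_le_iff, globalCotorsionDim_le_iff,
      globalCotorsionDim_le_iff, key]
  -- An element of ℕ∞ is determined by its finite upper bounds; ⊤ has none.
  have le_of {a b : ℕ∞} (hab : ∀ n : ℕ, b ≤ n → a ≤ n) : a ≤ b := by
    induction b with
    | top => exact le_top
    | coe n => exact hab n le_rfl
  exact le_antisymm (le_of fun n => (h n).2) (le_of fun n => (h n).1)
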